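/- Let $n\ge 1$ and let $b_1,\dots,b_n$ be nonnegative integers less than $n$. In the bounded budget network creation game with budgets $b_1,\dots,b_n$, each player $i\in\{1,\dots,n\}$ chooses a set $S_i\subseteq\{1,\dots,n\}\setminus\{i\}$ with $|S_i|=b_i$. The resulting directed graph $G$ on $\{1,\dots,n\}$, with an arc from $i$ to $j$ whenever $j\in S_i$, is called a realization of the game. Let $\operatorname{dist}(u,v)$ be the distance of $u$ and $v$ in the undirected graph underlying $G$, where $\operatorname{dist}(u,v)=n^2$ if $u$ and $v$ lie in different connected components, and let $\operatorname{diam}(G)=\max_{u,v}\operatorname{dist}(u,v)$. In the SUM version of the game the cost of player $u$ is $\sum_v\operatorname{dist}(u,v)$, and $G$ is an equilibrium graph if no player can decrease its cost by changing only its own set $S_i$ to another admissible set of size $b_i$. If $n \ge 2$, the price of anarchy of the game is the maximum of $\operatorname{diam}(G)$ over all equilibrium graphs $G$ divided by the minimum of $\operatorname{diam}(G)$ over all realizations $G$. (1) There is an absolute constant $C>0$ such that, for all $n\ge 1$ and all budgets $b_1,\dots,b_n$ as above, every equilibrium graph $G$ of the SUM version whose underlying undirected graph is connected satisfies $\operatorname{diam}(G)\le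 2^{C\sqrt{\log_2 n}}$. (2) Consequently, there is an absolute constant $C>0$ such that, for all $n\ge 2$ and all budgets $b_1,\dots,b_n$ as above, the price of anarchy of the SUM version is at most $2^{C\sqrt{\log_2 n}}$. -/

import Mathlib

namespace BudgetGame

/-- A strategy profile on the players `Fin n`, identified with the directed graph that it
builds: `j ∈ S i` means that player `i` owns an arc from `i` to `j`. -/
abbrev Profile (n : ℕ) := Fin n → Finset (Fin n)

/-- `S` is a realization of the game with budgets `b`: each player `i` owns exactly `b i` arcs,
all of them to other players. -/
def IsRealization {n : ℕ} (b : Fin n → ℕ) (S : Profile n) : Prop :=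
  ∀ i, i ∉ S i ∧ (S i).card = b i

/-- The underlying undirected graph. (A brace gives a double edge in the multigraph; this does
not affect distances.) -/
def underlying {n : ℕ} (S : Profile n) : SimpleGraph (Fin n) :=
  SimpleGraph.fromRel fun i j => j ∈ S i

open Classical in
/-- The distance of two vertices in the underlying graph, where vertices in different connected
components have distance `n ^ 2`. -/
noncomputable def dist {n : ℕ} (S : Profile n) (u v : Fin n) : ℕ :=
  if (underlying S).Reachable u v then (underlying S).dist u v else n ^ 2

/-- The maximum distance between two vertices. -/
noncomputable def diam {n : ℕ} (S : Profile n) : ℕ :=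
  Finset.univ.sup fun p : Fin n × Fin n => dist S p.1 p.2

/-- The cost of a vertex in the SUM version. -/
noncomputable def costSum {n : ℕ} (S : Profile n) (u : Fin n) : ℕ :=
  ∑ v, dist S u v

/-- `S` is a (pure) Nash equilibrium of the SUM version of the game with budgets `b`: no player
can decrease its cost by switching to another admissible strategy `T` while the strategies of
the other players are kept. -/
def IsSumEquilibrium {n : ℕ} (b : Fin n → ℕ) (S : Profile n) : Prop :=
  IsRealization b S ∧
    ∀ (i : Fin n) (T : Finset (Fin n)), i ∉ T → T.card = b i →
      costSum S i ≤ costSum (Function.update S i T) i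

/-- The price of anarchy of the SUM version: the maximum diameter of an equilibrium graph over
the minimum diameter of a realization. Both sets are finite. -/
noncomputable def priceOfAnarchySum {n : ℕ} (b : Fin n → ℕ) : ℝ :=
  ((sSup {d : ℕ | ∃ S : Profile n, IsSumEquilibrium b S ∧ diam S = d} : ℕ) : ℝ) /
    ((sInf {d : ℕ | ∃ S : Profile n, IsRealization b S ∧ diam S = d} : ℕ) : ℝ)

end BudgetGame

/-! In an equilibrium the owner of an arc cannot gain by redirecting it, so in a connected
equilibrium every edge is `SwapStable` at one of its ends. Bound (1) holds for all connected graphs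
with this property. Let n ≤ 2^(s²), Q = s² and L = (2Q+4)(Q+1).

Suppose first that breadth-first search from some r sees a tree up to level L. Then no vertex has
level L or more (`TreeLike.dist_lt`). Otherwise look at the vertices with a descendant at level at
least L. Either they double in number every 2Q+4 levels, too often for n vertices, or there is a
stem of that length. Stability of a stem edge makes the number of vertices beyond it halve or the
number before it double, so stems have length O(log n).

Suppose now that no search sees a tree. Then within L of every vertex there is an edge avoided by
some breadth-first tree, and deleting it costs its stable end at most 2L per vertex
(`Connected.exists_hasCheapEdge`). Since swapping it for an edge to a remote vertex does not pay,
balls with at most half of the vertices grow by a factor 2^s when their radius, already about L·2^s,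
is quadrupled. After s+1 rounds every ball has more than half of the vertices, and any two balls
meet.

For (2), a disconnected equilibrium is a forest without double arcs, since a redundant arc would be
better spent on another component. Its budgets are then too small for any connected realization, and
the ratio is 1. -/

namespace SimpleGraph

/-! ### Edge swaps and cheap edges. -/

section Swap

variable {V : Type*} {G : SimpleGraph V}

lemma Connected.exists_adj_dist_eq_succ (hG : G.Connected) {u v : V} (h : u ≠ v) :
    ∃ w, G.Adj u w ∧ G.dist u v = G.dist w v + 1 := by
  obtain ⟨p, hp⟩ := hG.exists_walk_length_eq_dist u v
  cases p with
  | nil => exact absurd rfl h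
  | cons hadj p =>
    rename_i w
    refine ⟨w, hadj, ?_⟩
    have h1 : G.dist w v ≤ p.length := dist_le p
    have h2 := hG.dist_triangle (u := u) (v := w) (w := v)
    have h3 : G.dist u w = 1 := dist_eq_one_iff_adj.2 hadj
    simp only [Walk.length_cons] at hp
    omega

lemma Connected.dist_le_dist_add_one (hG : G.Connected) {u w : V} (h : G.Adj u w) (v : V) :
    G.dist u v ≤ G.dist w v + 1 := by
  have h2 := hG.dist_triangle (u := u) (v := w) (w := v)
  rw [dist_eq_one_iff_adj.2 h] at h2
  omega

lemma Connected.exists_dist_eq (hG : G.Connected) (u v : V) {m : ℕ} (hm : m ≤ G.dist u v) :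
    ∃ w, G.dist u w = m ∧ G.dist w v + m = G.dist u v := by
  induction m with
  | zero => exact ⟨u, dist_self, rfl⟩
  | succ m ih =>
    obtain ⟨w, h1, h2⟩ := ih (by omega)
    have hwv : w ≠ v := by rintro rfl; omega
    obtain ⟨w', hw, hd⟩ := hG.exists_adj_dist_eq_succ hwv
    have h3 := hG.dist_triangle (u := u) (v := w') (w := v)
    have h4 := hG.dist_le_dist_add_one hw.symm u
    rw [dist_comm, dist_comm (u := w)] at h4
    exact ⟨w', by omega, by omega⟩

lemma edist_le_add_one {u w : V} (h : G.Adj u w) {v : V} {k : ℕ}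
    (hk : G.edist w v ≤ k) : G.edist u v ≤ (k + 1 : ℕ) := by
  calc G.edist u v ≤ G.edist u w + G.edist w v := SimpleGraph.edist_triangle
    _ ≤ 1 + k := add_le_add (edist_eq_one_iff_adj.2 h).le hk
    _ = (k + 1 : ℕ) := by push_cast; exact add_comm _ _

/-- A geodesic to `v` from a vertex closer to `v` than `x` avoids `x`, so it survives any change of
the edges at `x`. Working with `edist` avoids asking whether `H` is connected. -/
lemma Connected.edist_le_dist_of_adj_of_ne (hG : G.Connected) {H : SimpleGraph V} {x : V}
    (hH : ∀ p q, p ≠ x → q ≠ x → G.Adj p q → H.Adj p q) {v : V} :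
    ∀ a, G.dist a v < G.dist x v → H.edist a v ≤ G.dist a v := by
  suffices ∀ k a, G.dist a v = k → k < G.dist x v → H.edist a v ≤ k from
    fun a h => this _ a rfl h
  intro k
  induction k with
  | zero =>
    intro a ha _
    rw [hG.dist_eq_zero_iff] at ha
    subst ha
    simp
  | succ k ih =>
    intro a ha hk
    have hav : a ≠ v := by rintro rfl; simp at ha
    obtain ⟨w, hw, hd⟩ := hG.exists_adj_dist_eq_succ hav
    refine edist_le_add_one (hH a w ?_ ?_ hw) (ih w (by omega) (by omega))
    · rintro rfl; omega
    · rintro rfl; omega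

/-- The graph in which the edge `xy` has been replaced by the edge `xz`. -/
def swapEdge (G : SimpleGraph V) (x y z : V) : SimpleGraph V :=
  G.deleteEdges {s(x, y)} ⊔ edge x z

lemma swapEdge_adj_of_ne {x y z p q : V} (hp : p ≠ x) (hq : q ≠ x) (h : G.Adj p q) :
    (G.swapEdge x y z).Adj p q := by
  left
  rw [deleteEdges_adj]
  refine ⟨h, ?_⟩
  simp only [Set.mem_singleton_iff, Sym2.eq_iff, not_or, not_and]
  exact ⟨fun h => absurd h hp, fun _ h => absurd h hq⟩

lemma swapEdge_adj_left {x y z w : V} (hw : w ≠ y) (h : G.Adj x w) :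
    (G.swapEdge x y z).Adj x w := by
  left
  rw [deleteEdges_adj]
  refine ⟨h, ?_⟩
  simp only [Set.mem_singleton_iff, Sym2.eq_iff, not_or, not_and]
  exact ⟨fun _ => hw, fun _ h' => h.ne h'.symm⟩

lemma swapEdge_adj_new {x y z : V} (hz : z ≠ x) : (G.swapEdge x y z).Adj x z := by
  right
  rw [edge_adj]
  exact ⟨Or.inl ⟨rfl, rfl⟩, hz.symm⟩

/-- Replacing the edge `xy` by another edge at `x` never decreases the sum of the distances
from `x`. -/
def SwapStable [Fintype V] (G : SimpleGraph V) (x y : V) : Prop :=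
  ∀ z, z ≠ x → ¬ G.Adj x z → ∀ f : V → ℕ, (∀ v, (G.swapEdge x y z).edist x v ≤ f v) →
    ∑ v, G.dist x v ≤ ∑ v, f v

-- After the swap, a vertex with a geodesic from `x` through `y` and then `z` is one step closer.
-- Any other vertex with a geodesic through `y` is at most one step further, by the detour `x`, `z`,
-- `y`. The remaining vertices have a geodesic that starts with another edge. Stability says that
-- the winners do not outnumber the losers.
open Classical in
lemma SwapStable.card_le [Fintype V] (hG : G.Connected) {x y z : V} (hxy : G.Adj x y)
    (hs : G.SwapStable x y) (hyz : G.Adj y z) (hxz : G.dist x z = 2) :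
    (Finset.univ.filter fun v => G.dist x v = G.dist z v + 2).card ≤
      (Finset.univ.filter fun v => G.dist x v = G.dist y v + 1 ∧
        G.dist x v ≠ G.dist z v + 2).card := by
  have hzx : z ≠ x := by rintro rfl; simp at hxz
  have hnadj : ¬ G.Adj x z := by
    intro h
    rw [dist_eq_one_iff_adj.2 h] at hxz
    omega
  have key := hs z hzx hnadj (fun v => if G.dist x v = G.dist z v + 2 then G.dist x v - 1 else
    if G.dist x v = G.dist y v + 1 then G.dist x v + 1 else G.dist x v) (by
    intro v
    split_ifs with h1 h2
    · have := hG.edist_le_dist_of_adj_of_ne (H := G.swapEdge x y z) (x := x) (v := v)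
        (fun p q hp hq h => swapEdge_adj_of_ne hp hq h) z (by omega)
      have := edist_le_add_one (swapEdge_adj_new (G := G) (y := y) hzx) this
      rwa [show G.dist x v - 1 = G.dist z v + 1 by omega]
    · have := hG.edist_le_dist_of_adj_of_ne (H := G.swapEdge x y z) (x := x) (v := v)
        (fun p q hp hq h => swapEdge_adj_of_ne hp hq h) y (by omega)
      have := edist_le_add_one (swapEdge_adj_of_ne hzx hxy.ne' hyz.symm) this
      have := edist_le_add_one (swapEdge_adj_new (G := G) (y := y) hzx) this
      rwa [h2]
    · by_cases hv : x = v
      · subst hv; simp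
      · obtain ⟨w, hw, hd⟩ := hG.exists_adj_dist_eq_succ hv
        have := hG.edist_le_dist_of_adj_of_ne (H := G.swapEdge x y z) (x := x) (v := v)
          (fun p q hp hq h => swapEdge_adj_of_ne hp hq h) w (by omega)
        rw [hd]
        refine edist_le_add_one (swapEdge_adj_left ?_ hw) this
        rintro rfl
        exact h2 hd)
  have h2 : ∑ v, ((if G.dist x v = G.dist z v + 2 then G.dist x v - 1 else
      if G.dist x v = G.dist y v + 1 then G.dist x v + 1 else G.dist x v) +
        (if G.dist x v = G.dist z v + 2 then 1 else 0)) =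
      ∑ v, (G.dist x v + (if G.dist x v = G.dist y v + 1 ∧ G.dist x v ≠ G.dist z v + 2
        then 1 else 0)) := by
    refine Finset.sum_congr rfl fun v _ => ?_
    split_ifs <;> omega
  rw [Finset.sum_add_distrib, Finset.sum_add_distrib, ← Finset.card_filter,
    ← Finset.card_filter] at h2
  omega

/-- Some edge at `x` can be removed at the expense of at most `M` for every vertex. -/
def HasCheapEdge [Fintype V] (G : SimpleGraph V) (M : ℕ) (x : V) : Prop :=
  ∃ y, G.Adj x y ∧ G.SwapStable x y ∧
    ∀ v, (G.deleteEdges {s(x, y)}).edist x v ≤ (G.dist x v + M : ℕ)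

/-- The hypothesis provides a breadth-first tree from `r` that avoids `xy`. After the deletion one
can still travel from `x` to `v` through `r` inside this tree. -/
lemma Connected.edist_deleteEdges_le (hG : G.Connected) {r x y : V}
    (h : ∀ v, v ≠ r → ∃ w, G.Adj v w ∧ G.dist r v = G.dist r w + 1 ∧ s(v, w) ≠ s(x, y)) (v : V) :
    (G.deleteEdges {s(x, y)}).edist x v ≤ (G.dist x v + 2 * G.dist r x : ℕ) := by
  have key : ∀ k v, G.dist r v = k → (G.deleteEdges {s(x, y)}).edist v r ≤ k := by
    intro k
    induction k with
    | zero =>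
      intro v hv
      rw [hG.dist_eq_zero_iff] at hv
      subst hv
      simp
    | succ k ih =>
      intro v hv
      obtain ⟨w, hw, hd, hne⟩ := h v (by rintro rfl; simp at hv)
      refine edist_le_add_one ?_ (ih w (by omega))
      rw [deleteEdges_adj]
      exact ⟨hw, hne⟩
  have h1 := hG.dist_triangle (u := r) (v := x) (w := v)
  calc (G.deleteEdges {s(x, y)}).edist x v
      ≤ (G.deleteEdges {s(x, y)}).edist x r + (G.deleteEdges {s(x, y)}).edist r v :=
        SimpleGraph.edist_triangle
    _ ≤ (G.dist r x : ℕ∞) + (G.dist r v : ℕ∞) :=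
        add_le_add (key _ x rfl) (by rw [edist_comm]; exact key _ v rfl)
    _ ≤ (G.dist x v + 2 * G.dist r x : ℕ) := by
        norm_cast
        omega

/-- Up to level `L` the breadth-first search from `r` sees a tree. -/
structure TreeLike (G : SimpleGraph V) (r : V) (L : ℕ) : Prop where
  dist_ne : ∀ x y, G.Adj x y → G.dist r x ≤ L → G.dist r x ≠ G.dist r y
  parent_unique : ∀ c p q, G.dist r c ≤ L → G.Adj c p → G.Adj c q →
    G.dist r c = G.dist r p + 1 → G.dist r c = G.dist r q + 1 → p = q

lemma Connected.exists_hasCheapEdge [Fintype V] (hG : G.Connected)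
    (hs : ∀ x y, G.Adj x y → G.SwapStable x y ∨ G.SwapStable y x) {r : V} {L : ℕ}
    (h : ¬ G.TreeLike r L) : ∃ x, G.dist r x ≤ L ∧ G.HasCheapEdge (2 * L) x := by
  suffices ∃ x y, G.Adj x y ∧ G.dist r x ≤ L ∧ G.dist r y ≤ L ∧
      ∀ v, v ≠ r → ∃ w, G.Adj v w ∧ G.dist r v = G.dist r w + 1 ∧ s(v, w) ≠ s(x, y) by
    obtain ⟨x, y, hxy, hx, hy, hw⟩ := this
    rcases hs x y hxy with h1 | h1
    · refine ⟨x, hx, y, hxy, h1, fun v => (hG.edist_deleteEdges_le hw v).trans ?_⟩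
      norm_cast
      omega
    · rw [Sym2.eq_swap] at hw
      refine ⟨y, hy, x, hxy.symm, h1, fun v => (hG.edist_deleteEdges_le hw v).trans ?_⟩
      norm_cast
      omega
  have hpar : ∀ v, v ≠ r → ∃ w, G.Adj v w ∧ G.dist r v = G.dist r w + 1 := by
    intro v hv
    obtain ⟨w, hw, hd⟩ := hG.exists_adj_dist_eq_succ hv
    exact ⟨w, hw, by rw [dist_comm, hd, dist_comm]⟩
  -- Now every edge with both ends at level at most `L` is the only parent edge of some vertex. This
  -- fails for an edge inside a level, and for one of two parent edges of the same vertex.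
  by_contra hcon
  push Not at hcon
  refine h ⟨fun x y hxy hx hd => ?_, fun c p q hc hp hq hdp hdq => ?_⟩
  · obtain ⟨v, hv, hv'⟩ := hcon x y hxy hx (hd ▸ hx)
    obtain ⟨w, hw, hdw⟩ := hpar v hv
    have := hv' w hw hdw
    rw [Sym2.eq_iff] at this
    rcases this with ⟨rfl, rfl⟩ | ⟨rfl, rfl⟩ <;> omega
  · by_contra hpq
    obtain ⟨v, hv, hv'⟩ := hcon c p hp hc (by omega)
    by_cases hvc : v = c
    · subst hvc
      have := hv' q hq hdq
      rw [Sym2.eq_iff] at this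
      rcases this with ⟨_, h1⟩ | ⟨rfl, h1⟩
      · exact hpq h1.symm
      · exact hp.ne rfl
    · obtain ⟨w, hw, hdw⟩ := hpar v hv
      have := hv' w hw hdw
      rw [Sym2.eq_iff] at this
      rcases this with ⟨h1, _⟩ | ⟨rfl, rfl⟩
      · exact hvc h1
      · omega

end Swap

end SimpleGraph

namespace SimpleGraph

/-! ### Descendants in the tree-like part. -/

section Tree

variable {V : Type*} {G : SimpleGraph V} {r : V} {L : ℕ}

/-- Some shortest path from `r` to `v` passes through `c`. -/
def Below (G : SimpleGraph V) (r c v : V) : Prop :=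
  G.dist r v = G.dist r c + G.dist c v

/-- Some vertex of level at least `L` lies below `c`. -/
def Reaches (G : SimpleGraph V) (r : V) (L : ℕ) (c : V) : Prop :=
  ∃ v, G.Below r c v ∧ L ≤ G.dist r v

lemma Below.refl (r c : V) : G.Below r c c := by simp [Below]

lemma Below.trans (hG : G.Connected) {a b c : V} (h1 : G.Below r a b) (h2 : G.Below r b c) :
    G.Below r a c := by
  unfold Below at *
  have := hG.dist_triangle (u := r) (v := a) (w := c)
  have := hG.dist_triangle (u := a) (v := b) (w := c)
  omega

lemma below_of_adj {a b : V} (h : G.Adj a b) (hd : G.dist r b = G.dist r a + 1) :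
    G.Below r a b := by
  rw [Below, hd, dist_eq_one_iff_adj.2 h]

lemma Reaches.of_below (hG : G.Connected) {a b : V} (h : G.Below r a b) (hb : G.Reaches r L b) :
    G.Reaches r L a := by
  obtain ⟨v, hv, hL⟩ := hb
  exact ⟨v, h.trans hG hv, hL⟩

lemma Connected.exists_child_of_below (hG : G.Connected) {c v : V} (h : G.Below r c v)
    (hne : c ≠ v) : ∃ w, G.Adj c w ∧ G.dist r w = G.dist r c + 1 ∧ G.Below r w v ∧
      G.dist c v = G.dist w v + 1 := by
  obtain ⟨w, hw, hd⟩ := hG.exists_adj_dist_eq_succ hne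
  have h1 := hG.dist_triangle (u := r) (v := w) (w := v)
  have h2 := hG.dist_le_dist_add_one hw.symm r
  rw [dist_comm, dist_comm (u := c)] at h2
  unfold Below at *
  exact ⟨w, hw, by omega, by omega, hd⟩

lemma Connected.exists_parent_of_below (hG : G.Connected) {c v : V} (h : G.Below r c v)
    (hne : c ≠ v) : ∃ w, G.Adj v w ∧ G.dist r v = G.dist r w + 1 ∧ G.Below r c w ∧
      G.dist c v = G.dist c w + 1 := by
  obtain ⟨w, hw, hd⟩ := hG.exists_adj_dist_eq_succ hne.symm
  rw [dist_comm, dist_comm (u := w)] at hd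
  have h1 := hG.dist_triangle (u := r) (v := c) (w := w)
  have h2 := hG.dist_le_dist_add_one hw r
  rw [dist_comm, dist_comm (u := w)] at h2
  unfold Below at *
  exact ⟨w, hw, by omega, by omega, hd⟩

lemma Connected.dist_cases (hG : G.Connected) {u v : V} (h : G.Adj u v) (r : V) :
    G.dist r v = G.dist r u ∨ G.dist r v = G.dist r u + 1 ∨ G.dist r u = G.dist r v + 1 := by
  have h1 := hG.dist_le_dist_add_one h r
  have h2 := hG.dist_le_dist_add_one h.symm r
  rw [dist_comm, dist_comm (u := v)] at h1
  rw [dist_comm, dist_comm (u := u)] at h2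
  omega

namespace TreeLike

/-- Below level `L` a geodesic that has stepped down from `p` to `c` can neither move sideways nor
return to the unique parent. It descends until it ends at `v` or arrives at level `L`. -/
lemma below_or_reaches (hT : G.TreeLike r L) (hG : G.Connected) {v : V} :
    ∀ {p c : V}, G.Adj p c → G.dist r c = G.dist r p + 1 → G.dist r c ≤ L →
      G.dist p v = G.dist c v + 1 → G.Below r c v ∨ G.Reaches r L c := by
  suffices ∀ k p c, G.dist c v = k → G.Adj p c → G.dist r c = G.dist r p + 1 → G.dist r c ≤ L →
      G.dist p v = G.dist c v + 1 → G.Below r c v ∨ G.Reaches r L c from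
    fun {_ _} h1 h2 h3 h4 => this _ _ _ rfl h1 h2 h3 h4
  intro k
  induction k with
  | zero =>
    intro p c hk _ _ _ _
    rw [hG.dist_eq_zero_iff] at hk
    subst hk
    exact Or.inl (Below.refl _ _)
  | succ k ih =>
    intro p c hk hpc hd hL hpv
    rcases hL.eq_or_lt with hL' | hL'
    · exact Or.inr ⟨c, Below.refl _ _, hL'.ge⟩
    have hcv : c ≠ v := by rintro rfl; simp at hk
    obtain ⟨w, hw, hdw⟩ := hG.exists_adj_dist_eq_succ hcv
    rcases hG.dist_cases hw r with h | h | h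
    · exact absurd h.symm (hT.dist_ne c w hw hL)
    · have hb := below_of_adj hw h
      rcases ih c w (by omega) hw h (by omega) hdw with h' | h'
      · exact Or.inl (hb.trans hG h')
      · exact Or.inr (h'.of_below hG hb)
    · have := hT.parent_unique c p w hL hpc.symm hw hd h
      subst this
      omega

lemma ancestor_unique (hT : G.TreeLike r L) (hG : G.Connected) {a b : V}
    (hab : G.dist r a = G.dist r b) : ∀ {v : V}, G.dist r v ≤ L → G.Below r a v →
      G.Below r b v → a = b := by
  suffices ∀ k v, G.dist a v = k → G.dist r v ≤ L → G.Below r a v → G.Below r b v → a = b from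
    fun {_} h1 h2 h3 => this _ _ rfl h1 h2 h3
  intro k
  induction k with
  | zero =>
    intro v hk _ ha hb
    have hb' : G.dist b v = 0 := by
      unfold Below at *
      omega
    rw [hG.dist_eq_zero_iff] at hk hb'
    rw [hk, hb']
  | succ k ih =>
    intro v hk hL ha hb
    have hav : a ≠ v := by rintro rfl; simp at hk
    have hbv : b ≠ v := by
      rintro rfl
      unfold Below at ha
      omega
    obtain ⟨p, hp, hdp, hap, hkp⟩ := hG.exists_parent_of_below ha hav
    obtain ⟨q, hq, hdq, hbq, -⟩ := hG.exists_parent_of_below hb hbv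
    have := hT.parent_unique v p q hL hp hq hdp hdq
    subst this
    exact ih p (by omega) (by omega) hap hbq

/-- If no vertex below `c` has level `L`, then the vertices below `c` hang from its parent. -/
lemma dist_add_one_add_le (hT : G.TreeLike r L) (hG : G.Connected) {p c z : V} (hpc : G.Adj p c)
    (hd : G.dist r c = G.dist r p + 1) (hc : ¬ G.Reaches r L c) (hz : ¬ G.Below r c z) :
    ∀ {v : V}, G.Below r c v → G.dist p z + 1 + G.dist c v ≤ G.dist v z := by
  suffices ∀ k v, G.dist v z = k → G.Below r c v → G.dist p z + 1 + G.dist c v ≤ k from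
    fun {_} h => this _ _ rfl h
  intro k
  induction k with
  | zero =>
    intro v hk hv
    rw [hG.dist_eq_zero_iff] at hk
    subst hk
    exact absurd hv hz
  | succ k ih =>
    intro v hk hv
    have hvz : v ≠ z := by rintro rfl; simp at hk
    have hvL : G.dist r v < L := by
      by_contra h
      exact hc ⟨v, hv, not_lt.1 h⟩
    obtain ⟨w, hw, hdw⟩ := hG.exists_adj_dist_eq_succ hvz
    have hcw := hG.dist_le_dist_add_one hw c
    rw [dist_comm, dist_comm (u := w)] at hcw
    rcases hG.dist_cases hw r with h | h | h
    · exact absurd h.symm (hT.dist_ne v w hw hvL.le)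
    · have := ih w (by omega) (hv.trans hG (below_of_adj hw h))
      omega
    · by_cases hcv : c = v
      · subst hcv
        have := hT.parent_unique c p w hvL.le hpc.symm hw hd h
        subst this
        rw [dist_self]
        omega
      · obtain ⟨w', hw', hdw', hcw', -⟩ := hG.exists_parent_of_below hv hcv
        have := hT.parent_unique v w w' hvL.le hw hw' h hdw'
        subst this
        have := ih w (by omega) hcw'
        omega

end TreeLike

/-! ### Stems and their logarithmic length. -/

lemma Reaches.exists_child (hG : G.Connected) {c : V} (h : G.Reaches r L c)
    (hc : G.dist r c < L) :
    ∃ w, G.Adj c w ∧ G.dist r w = G.dist r c + 1 ∧ G.Reaches r L w := by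
  obtain ⟨v, hv, hL⟩ := h
  have hcv : c ≠ v := by rintro rfl; omega
  obtain ⟨w, hw, hd, hb, -⟩ := hG.exists_child_of_below hv hcv
  exact ⟨w, hw, hd, v, hb, hL⟩

/-- A descending path `x 0, …, x ℓ` of vertices that reach level `L`, such that no other child of
an `x i` with `i < ℓ` reaches level `L`. -/
structure IsStem (G : SimpleGraph V) (r : V) (L ℓ : ℕ) (x : ℕ → V) : Prop where
  adj : ∀ i < ℓ, G.Adj (x i) (x (i + 1))
  dist_succ : ∀ i < ℓ, G.dist r (x (i + 1)) = G.dist r (x i) + 1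
  dist_le : ∀ i ≤ ℓ, G.dist r (x i) ≤ L
  reaches : ∀ i ≤ ℓ, G.Reaches r L (x i)
  child_unique : ∀ i < ℓ, ∀ w, G.Adj (x i) w → G.dist r w = G.dist r (x i) + 1 →
    G.Reaches r L w → w = x (i + 1)

lemma Connected.exists_isStem (hG : G.Connected) (hT : G.TreeLike r L) {c : V} {ℓ : ℕ}
    (hc : G.Reaches r L c) (hL : G.dist r c + ℓ ≤ L)
    (huniq : ∀ a b, G.Below r c a → G.Below r c b → G.Reaches r L a → G.Reaches r L b →
      G.dist r a = G.dist r c + ℓ → G.dist r b = G.dist r c + ℓ → a = b) :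
    ∃ x, G.IsStem r L ℓ x := by
  have hch : ∀ v, ∃ w, G.Reaches r L v → G.dist r v < L →
      G.Adj v w ∧ G.dist r w = G.dist r v + 1 ∧ G.Reaches r L w := by
    intro v
    by_cases h : G.Reaches r L v ∧ G.dist r v < L
    · obtain ⟨w, hw⟩ := h.1.exists_child hG h.2
      exact ⟨w, fun _ _ => hw⟩
    · exact ⟨v, fun h1 h2 => absurd ⟨h1, h2⟩ h⟩
  choose f hf using hch
  have hdown : ∀ m v, G.Reaches r L v → G.dist r v + m ≤ L →
      G.Reaches r L (f^[m] v) ∧ G.dist r (f^[m] v) = G.dist r v + m ∧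
        G.Below r v (f^[m] v) := by
    intro m
    induction m with
    | zero => exact fun v hv _ => ⟨hv, rfl, Below.refl _ _⟩
    | succ m ih =>
      intro v hv hm
      obtain ⟨h1, h2, h3⟩ := ih v hv (by omega)
      obtain ⟨h4, h5, h6⟩ := hf _ h1 (by omega)
      rw [Function.iterate_succ_apply']
      exact ⟨h6, by omega, h3.trans hG (below_of_adj h4 h5)⟩
  have hx : ∀ i ≤ ℓ, G.Reaches r L (f^[i] c) ∧ G.dist r (f^[i] c) = G.dist r c + i ∧
      G.Below r c (f^[i] c) := fun i hi => hdown i c hc (by omega)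
  have hstep : ∀ i < ℓ, G.Adj (f^[i] c) (f^[i + 1] c) := by
    intro i hi
    obtain ⟨h1, h2, -⟩ := hx i hi.le
    rw [Function.iterate_succ_apply']
    exact (hf _ h1 (by omega)).1
  refine ⟨fun i => f^[i] c, hstep, fun i hi => ?_, fun i hi => ?_, fun i hi => (hx i hi).1, ?_⟩
  · have := (hx i hi.le).2.1
    have := (hx (i + 1) hi).2.1
    show G.dist r (f^[i + 1] c) = G.dist r (f^[i] c) + 1
    omega
  · have := (hx i hi).2.1
    show G.dist r (f^[i] c) ≤ L
    omega
  · intro i hi w hw hd hr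
    change G.Adj (f^[i] c) w at hw
    change G.dist r w = G.dist r (f^[i] c) + 1 at hd
    obtain ⟨-, h2, h3⟩ := hx i hi.le
    obtain ⟨h1', h2', h3'⟩ := hx (i + 1) hi
    have hwc := h3.trans hG (below_of_adj hw hd)
    -- Descend from the rival child `w` and from the next stem vertex to the final level. By `huniq`
    -- the two endpoints agree, and then so do their ancestors `w` and `f^[i + 1] c`.
    obtain ⟨m, rfl⟩ : ∃ m, ℓ = i + 1 + m := ⟨ℓ - (i + 1), by omega⟩
    obtain ⟨a1, a2, a3⟩ := hdown m w hr (by omega)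
    obtain ⟨b1, b2, b3⟩ := hdown m (f^[i + 1] c) h1' (by omega)
    have hab := huniq _ _ (hwc.trans hG a3) (h3'.trans hG b3) a1 b1 (by omega) (by omega)
    rw [← hab] at b3
    exact hT.ancestor_unique hG (by omega) (by omega) a3 b3

namespace IsStem

variable {ℓ : ℕ} {x : ℕ → V}

lemma dist_add (h : G.IsStem r L ℓ x) : ∀ m i, i + m ≤ ℓ →
    G.dist r (x (i + m)) = G.dist r (x i) + m := by
  intro m i
  induction m with
  | zero => intro _; rfl
  | succ m ih =>
    intro hm
    rw [← add_assoc, h.dist_succ (i + m) (by omega), ih (by omega), add_assoc]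

lemma below (h : G.IsStem r L ℓ x) (hG : G.Connected) : ∀ m i, i + m ≤ ℓ →
    G.Below r (x i) (x (i + m)) := by
  intro m i
  induction m with
  | zero => intro _; exact Below.refl _ _
  | succ m ih =>
    intro hm
    exact (ih (by omega)).trans hG (below_of_adj (h.adj (i + m) (by omega))
      (h.dist_succ (i + m) (by omega)))

lemma dist_eq (h : G.IsStem r L ℓ x) (hG : G.Connected) (m i : ℕ) (hm : i + m ≤ ℓ) :
    G.dist (x i) (x (i + m)) = m := by
  have h1 := h.dist_add m i hm
  have h2 := h.below hG m i hm
  unfold Below at h2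
  omega

/-- The vertices that branch off at `x t` are separated by it from the later `x i`. -/
lemma dist_of_branch (h : G.IsStem r L ℓ x) (hT : G.TreeLike r L) (hG : G.Connected) {t m : ℕ}
    (htm : t + (m + 1) ≤ ℓ) {v : V} (hv : G.Below r (x t) v) (hv' : ¬ G.Below r (x (t + 1)) v) :
    G.dist (x (t + (m + 1))) v = G.dist (x t) v + (m + 1) := by
  have hm := h.dist_eq hG (m + 1) t htm
  have htri := hG.dist_triangle (u := x (t + (m + 1))) (v := x t) (w := v)
  rw [dist_comm (u := x (t + (m + 1))) (v := x t)] at htri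
  by_cases htv : x t = v
  · subst htv
    rw [dist_comm, hm, dist_self, zero_add]
  obtain ⟨w, hw, hd, hwv, hdw⟩ := hG.exists_child_of_below hv htv
  have hwr : ¬ G.Reaches r L w := by
    intro hr
    exact hv' (h.child_unique t (by omega) w hw hd hr ▸ hwv)
  have := hT.dist_add_one_add_le hG hw hd hwr (z := x (t + (m + 1)))
    (fun hb => hwr ((h.reaches _ htm).of_below hG hb)) hwv
  rw [dist_comm (u := v)] at this
  omega

lemma exists_branch {v : V} (h0 : G.Below r (x 0) v) :
    ∀ {i : ℕ}, ¬ G.Below r (x i) v → ∃ t < i, G.Below r (x t) v ∧ ¬ G.Below r (x (t + 1)) v := by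
  intro i
  induction i with
  | zero => exact fun h' => absurd h0 h'
  | succ i ih =>
    intro hi
    by_cases hb : G.Below r (x i) v
    · exact ⟨i, by omega, hb, hi⟩
    · obtain ⟨t, ht, h1⟩ := ih hb
      exact ⟨t, by omega, h1⟩

open Classical in
/-- Number of vertices below `x i`. -/
noncomputable def lower [Fintype V] (G : SimpleGraph V) (r : V) (x : ℕ → V) (i : ℕ) : ℕ :=
  (Finset.univ.filter fun v => G.Below r (x i) v).card

open Classical in
/-- Number of vertices below `x 0` but not below `x i`. -/
noncomputable def upper [Fintype V] (G : SimpleGraph V) (r : V) (x : ℕ → V) (i : ℕ) : ℕ :=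
  (Finset.univ.filter fun v => G.Below r (x 0) v ∧ ¬ G.Below r (x i) v).card

variable [Fintype V]

/-- Swap the edge to `x (i + 1)` for one to `x (i + 2)`. Everything below `x (i + 2)` wins, and the
losers lie below `x (i + 1)` but not below `x (i + 2)`. -/
lemma two_mul_lower_le (h : G.IsStem r L ℓ x) (hT : G.TreeLike r L) (hG : G.Connected) {i : ℕ}
    (hi : i + 2 ≤ ℓ) (hs : G.SwapStable (x i) (x (i + 1))) :
    2 * lower G r x (i + 2) ≤ lower G r x (i + 1) := by
  classical
  have hcard := SwapStable.card_le (z := x (i + 2)) hG (h.adj i (by omega)) hs (h.adj (i + 1) (by omega))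
    (h.dist_eq hG 2 i hi)
  have hsub : (Finset.univ.filter fun v => G.Below r (x (i + 2)) v) ⊆
      Finset.univ.filter fun v => G.dist (x i) v = G.dist (x (i + 2)) v + 2 := by
    intro v hv
    simp only [Finset.mem_filter, Finset.mem_univ, true_and] at hv ⊢
    have h1 := (h.below hG 2 i hi).trans hG hv
    have h2 := h.dist_add 2 i hi
    unfold Below at *
    omega
  have hsub2 : (Finset.univ.filter fun v => G.dist (x i) v = G.dist (x (i + 1)) v + 1 ∧
      G.dist (x i) v ≠ G.dist (x (i + 2)) v + 2) ⊆
      (Finset.univ.filter fun v => G.Below r (x (i + 1)) v) \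
        Finset.univ.filter fun v => G.Below r (x (i + 2)) v := by
    intro v hv
    have hnb : v ∉ Finset.univ.filter fun v => G.Below r (x (i + 2)) v :=
      fun hc => (Finset.mem_filter.1 hv).2.2 (Finset.mem_filter.1 (hsub hc)).2
    simp only [Finset.mem_sdiff, Finset.mem_filter, Finset.mem_univ, true_and] at hv hnb ⊢
    -- The first step from `x (i + 1)` towards a loser leads neither up to `x i` nor on to `x (i +
    -- 2)`. It enters a side branch that stays above level `L`, hence the loser lies in that branch.
    refine ⟨?_, hnb⟩
    by_cases hxv : x (i + 1) = v
    · rw [hxv]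
      exact Below.refl _ _
    obtain ⟨w, hw, hdw⟩ := hG.exists_adj_dist_eq_succ hxv
    have hL := h.dist_le (i + 1) (by omega)
    have hL2 := h.dist_le (i + 2) (by omega)
    have hdi := h.dist_succ i (by omega)
    have hdi2 : G.dist r (x (i + 2)) = _ := h.dist_succ (i + 1) (by omega)
    rcases hG.dist_cases hw r with h' | h' | h'
    · exact absurd h'.symm (hT.dist_ne _ w hw hL)
    · rcases hT.below_or_reaches hG hw h' (by omega) hdw with hb | hb
      · exact (below_of_adj hw h').trans hG hb
      · have : w = x (i + 2) := h.child_unique (i + 1) (by omega) w hw h' hb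
        subst this
        exact absurd (by omega) hv.2
    · have := hT.parent_unique _ _ w hL (h.adj i (by omega)).symm hw hdi h'
      subst this
      omega
  have h3 := Finset.card_le_card hsub
  have h4 := Finset.card_le_card hsub2
  have hsub3 : (Finset.univ.filter fun v => G.Below r (x (i + 2)) v) ⊆
      Finset.univ.filter fun v => G.Below r (x (i + 1)) v := by
    intro v hv
    simp only [Finset.mem_filter, Finset.mem_univ, true_and] at hv ⊢
    exact (h.below hG 1 (i + 1) (by omega)).trans hG hv
  rw [Finset.card_sdiff_of_subset hsub3] at h4
  unfold lower
  have h5 := Finset.card_le_card hsub3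
  omega

/-- The mirror image of `two_mul_lower_le`, with the swap pointing back to `x i`. The vertices
branching off at `x 0, …, x i` win, and the losers hang at `x (i + 1)`. -/
lemma two_mul_upper_le (h : G.IsStem r L ℓ x) (hT : G.TreeLike r L) (hG : G.Connected) {i : ℕ}
    (hi : i + 2 ≤ ℓ) (hs : G.SwapStable (x (i + 2)) (x (i + 1))) :
    2 * upper G r x (i + 1) ≤ upper G r x (i + 2) := by
  classical
  have hcard := SwapStable.card_le (x := x (i + 2)) hG (h.adj (i + 1) (by omega)).symm hs
    (h.adj i (by omega)).symm (by rw [dist_comm]; exact h.dist_eq hG 2 i hi)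
  have hsub : (Finset.univ.filter fun v => G.Below r (x 0) v ∧ ¬ G.Below r (x (i + 1)) v) ⊆
      Finset.univ.filter fun v => G.dist (x (i + 2)) v = G.dist (x i) v + 2 := by
    intro v hv
    simp only [Finset.mem_filter, Finset.mem_univ, true_and] at hv ⊢
    obtain ⟨t, ht, hb, hnb⟩ := exists_branch hv.1 hv.2
    obtain ⟨m, hm⟩ := Nat.exists_eq_add_of_lt ht
    have h1 := h.dist_of_branch hT hG (t := t) (m := m + 1) (by omega) hb hnb
    rcases m with _ | m
    · obtain rfl : i = t := by omega
      exact h1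
    · have h2 := h.dist_of_branch hT hG (t := t) (m := m) (by omega) hb hnb
      obtain rfl : i = t + (m + 1) := by omega
      rw [show t + (m + 1) + 2 = t + (m + 1 + 1 + 1) by omega]
      omega
  have hmono : ∀ v, G.Below r (x (i + 2)) v → G.Below r (x (i + 1)) v := fun v hv =>
    (h.below hG 1 (i + 1) (by omega)).trans hG hv
  have hsub2 : (Finset.univ.filter fun v => G.dist (x (i + 2)) v = G.dist (x (i + 1)) v + 1 ∧
      G.dist (x (i + 2)) v ≠ G.dist (x i) v + 2) ⊆
      (Finset.univ.filter fun v => G.Below r (x 0) v ∧ ¬ G.Below r (x (i + 2)) v) \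
        Finset.univ.filter fun v => G.Below r (x 0) v ∧ ¬ G.Below r (x (i + 1)) v := by
    intro v hv
    have hnb : v ∉ Finset.univ.filter fun v => G.Below r (x 0) v ∧ ¬ G.Below r (x (i + 1)) v :=
      fun hc => (Finset.mem_filter.1 hv).2.2 (Finset.mem_filter.1 (hsub hc)).2
    simp only [Finset.mem_sdiff, Finset.mem_filter, Finset.mem_univ, true_and] at hv hnb ⊢
    refine ⟨?_, hnb⟩
    have h0 : ∀ u, G.Below r (x (i + 1)) u → G.Below r (x 0) u := by
      intro u hu
      have := h.below hG (i + 1) 0 (by omega)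
      rw [zero_add] at this
      exact this.trans hG hu
    have hL := h.dist_le (i + 1) (by omega)
    have hdi := h.dist_succ i (by omega)
    have hdi2 : G.dist r (x (i + 2)) = _ := h.dist_succ (i + 1) (by omega)
    have hL2 := h.dist_le (i + 2) (by omega)
    have hnot : ¬ G.Below r (x (i + 2)) v := by
      intro hb
      have := hmono v hb
      unfold Below at hb this
      omega
    refine ⟨h0 v ?_, hnot⟩
    by_cases hxv : x (i + 1) = v
    · rw [hxv]
      exact Below.refl _ _
    obtain ⟨w, hw, hdw⟩ := hG.exists_adj_dist_eq_succ hxv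
    rcases hG.dist_cases hw r with h' | h' | h'
    · exact absurd h'.symm (hT.dist_ne _ w hw hL)
    · rcases hT.below_or_reaches hG hw h' (by omega) hdw with hb | hb
      · exact (below_of_adj hw h').trans hG hb
      · have : w = x (i + 2) := h.child_unique (i + 1) (by omega) w hw h' hb
        subst this
        omega
    · have := hT.parent_unique _ _ w hL (h.adj i (by omega)).symm hw hdi h'
      subst this
      omega
  have h3 := Finset.card_le_card hsub
  have h4 := Finset.card_le_card hsub2
  have hsub3 : (Finset.univ.filter fun v => G.Below r (x 0) v ∧ ¬ G.Below r (x (i + 1)) v) ⊆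
      Finset.univ.filter fun v => G.Below r (x 0) v ∧ ¬ G.Below r (x (i + 2)) v := by
    intro v hv
    simp only [Finset.mem_filter, Finset.mem_univ, true_and] at hv ⊢
    exact ⟨hv.1, fun hb => hv.2 (hmono v hb)⟩
  rw [Finset.card_sdiff_of_subset hsub3] at h4
  unfold upper
  have h5 := Finset.card_le_card hsub3
  omega

/-- The quotient of `upper` at `m + 1` by `lower` at `m + 2` at least doubles with each `m`:
stability of the edge between `x (m + 1)` and `x (m + 2)` at its upper end halves the denominator,
at its lower end doubles the numerator. -/
lemma two_pow_le (h : G.IsStem r L ℓ x) (hT : G.TreeLike r L) (hG : G.Connected)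
    (hs : ∀ u v, G.Adj u v → G.SwapStable u v ∨ G.SwapStable v u) :
    ∀ m, m + 3 ≤ ℓ → 2 ^ m * (upper G r x 1 * lower G r x (m + 2)) ≤
      upper G r x (m + 1) * lower G r x 2 := by
  classical
  intro m
  induction m with
  | zero => intro _; simp
  | succ m ih =>
    intro hm
    have ih := ih (by omega)
    have hlow : lower G r x (m + 3) ≤ lower G r x (m + 2) := by
      refine Finset.card_le_card fun v hv => ?_
      simp only [Finset.mem_filter, Finset.mem_univ, true_and] at hv ⊢
      exact (h.below hG 1 (m + 2) (by omega)).trans hG hv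
    have hup : upper G r x (m + 1) ≤ upper G r x (m + 2) := by
      refine Finset.card_le_card fun v hv => ?_
      simp only [Finset.mem_filter, Finset.mem_univ, true_and] at hv ⊢
      exact ⟨hv.1, fun hb => hv.2 ((h.below hG 1 (m + 1) (by omega)).trans hG hb)⟩
    rw [show m + 1 + 2 = m + 3 by omega, show m + 1 + 1 = m + 2 by omega, pow_succ]
    rcases hs _ _ (h.adj (m + 1) (by omega)) with h1 | h1
    · have h2 : 2 * lower G r x (m + 3) ≤ lower G r x (m + 2) :=
        h.two_mul_lower_le hT hG (i := m + 1) (by omega) h1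
      calc 2 ^ m * 2 * (upper G r x 1 * lower G r x (m + 3))
          = 2 ^ m * (upper G r x 1 * (2 * lower G r x (m + 3))) := by ring
        _ ≤ 2 ^ m * (upper G r x 1 * lower G r x (m + 2)) := by gcongr
        _ ≤ upper G r x (m + 1) * lower G r x 2 := ih
        _ ≤ upper G r x (m + 2) * lower G r x 2 := by gcongr
    · have h2 : 2 * upper G r x (m + 1) ≤ upper G r x (m + 2) :=
        h.two_mul_upper_le hT hG (i := m) (by omega) h1
      calc 2 ^ m * 2 * (upper G r x 1 * lower G r x (m + 3))
          ≤ 2 ^ m * 2 * (upper G r x 1 * lower G r x (m + 2)) := by gcongr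
        _ = 2 * (2 ^ m * (upper G r x 1 * lower G r x (m + 2))) := by ring
        _ ≤ 2 * (upper G r x (m + 1) * lower G r x 2) := by gcongr
        _ = 2 * upper G r x (m + 1) * lower G r x 2 := by ring
        _ ≤ upper G r x (m + 2) * lower G r x 2 := by gcongr

/-- A stem has at most logarithmic length. -/
lemma two_pow_le_card_sq {m : ℕ} (h : G.IsStem r L (m + 3) x) (hT : G.TreeLike r L)
    (hG : G.Connected) (hs : ∀ u v, G.Adj u v → G.SwapStable u v ∨ G.SwapStable v u) :
    2 ^ m ≤ Fintype.card V * Fintype.card V := by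
  classical
  have h1 := h.two_pow_le hT hG hs m le_rfl
  have h2 : 1 ≤ upper G r x 1 := by
    refine Finset.card_pos.2 ⟨x 0, ?_⟩
    simp only [Finset.mem_filter, Finset.mem_univ, true_and]
    refine ⟨Below.refl _ _, fun hb => ?_⟩
    have : G.dist r (x 1) = _ := h.dist_succ 0 (by omega)
    unfold Below at hb
    omega
  have h3 : 1 ≤ lower G r x (m + 2) := by
    refine Finset.card_pos.2 ⟨x (m + 2), ?_⟩
    simp only [Finset.mem_filter, Finset.mem_univ, true_and]
    exact Below.refl _ _
  have h4 : upper G r x (m + 1) ≤ Fintype.card V := Finset.card_le_univ _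
  have h5 : lower G r x 2 ≤ Fintype.card V := Finset.card_le_univ _
  calc 2 ^ m = 2 ^ m * (1 * 1) := by ring
    _ ≤ 2 ^ m * (upper G r x 1 * lower G r x (m + 2)) := by gcongr
    _ ≤ upper G r x (m + 1) * lower G r x 2 := h1
    _ ≤ _ := by gcongr

end IsStem

end Tree

end SimpleGraph

namespace SimpleGraph

/-! ### Branching of the tree and growth of balls. -/

section Growth

variable {V : Type*} [Fintype V] {G : SimpleGraph V} {r : V} {L : ℕ}

/-- Without a stem, each vertex at level `ℓ * k` that reaches the bottom has two such descendants
`ℓ` levels further down. Unique ancestors keep the descendants of different vertices apart, so the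
count doubles `K` times. -/
lemma Connected.exists_isStem_or_two_pow_le (hG : G.Connected) {ℓ K : ℕ}
    (hT : G.TreeLike r (ℓ * K)) (hr : G.Reaches r (ℓ * K) r) :
    (∃ x, G.IsStem r (ℓ * K) ℓ x) ∨ 2 ^ K ≤ Fintype.card V := by
  classical
  by_contra hcon
  push Not at hcon
  obtain ⟨hno, hlt⟩ := hcon
  have key : ∀ k ≤ K, 2 ^ k ≤ (Finset.univ.filter fun v =>
      G.Reaches r (ℓ * K) v ∧ G.dist r v = ℓ * k).card := by
    intro k
    induction k with
    | zero =>
      intro _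
      rw [pow_zero, Nat.one_le_iff_ne_zero, ← Nat.pos_iff_ne_zero, Finset.card_pos]
      exact ⟨r, by simp [hr]⟩
    | succ k ih =>
      intro hk
      have ih := ih (by omega)
      have hle : ℓ * (k + 1) ≤ ℓ * K := Nat.mul_le_mul le_rfl hk
      have hpair : ∀ c, ∃ g : Bool → V, G.Reaches r (ℓ * K) c → G.dist r c = ℓ * k →
          g false ≠ g true ∧ ∀ t, G.Below r c (g t) ∧ G.Reaches r (ℓ * K) (g t) ∧
            G.dist r (g t) = ℓ * (k + 1) := by
        intro c
        by_cases h : G.Reaches r (ℓ * K) c ∧ G.dist r c = ℓ * k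
        · have hsum : G.dist r c + ℓ = ℓ * (k + 1) := by rw [h.2]; ring
          have hnu : ¬ ∀ a b, G.Below r c a → G.Below r c b → G.Reaches r (ℓ * K) a →
              G.Reaches r (ℓ * K) b → G.dist r a = G.dist r c + ℓ → G.dist r b = G.dist r c + ℓ →
              a = b := by
            intro hu
            obtain ⟨x, hx⟩ := hG.exists_isStem hT h.1 (by omega) hu
            exact hno x hx
          push Not at hnu
          obtain ⟨a, b, ha, hb, ha', hb', hda, hdb, hab⟩ := hnu
          refine ⟨fun t => if t then b else a, fun _ _ => ⟨by simpa using hab, fun t => ?_⟩⟩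
          cases t
          · exact ⟨ha, ha', hda.trans hsum⟩
          · exact ⟨hb, hb', hdb.trans hsum⟩
        · exact ⟨fun _ => c, fun h1 h2 => absurd ⟨h1, h2⟩ h⟩
      choose g hg using hpair
      calc 2 ^ (k + 1) = 2 ^ k * 2 := pow_succ _ _
        _ ≤ (Finset.univ.filter fun v => G.Reaches r (ℓ * K) v ∧ G.dist r v = ℓ * k).card * 2 := by
          gcongr
        _ = ((Finset.univ.filter fun v => G.Reaches r (ℓ * K) v ∧ G.dist r v = ℓ * k) ×ˢ
              (Finset.univ : Finset Bool)).card := by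
          rw [Finset.card_product]
          simp
        _ ≤ _ := by
          refine Finset.card_le_card_of_injOn (fun p => g p.1 p.2) ?_ ?_
          · rintro ⟨c, t⟩ hc
            simp only [Finset.coe_product, Finset.coe_filter, Finset.mem_univ, true_and,
              Finset.coe_univ, Set.mem_prod, Set.mem_ofPred_eq, Set.mem_univ, and_true] at hc ⊢
            exact ((hg c hc.1 hc.2).2 t).2
          · rintro ⟨c, t⟩ hc ⟨c', t'⟩ hc' heq
            simp only [Finset.coe_product, Finset.coe_filter, Finset.mem_univ, true_and,
              Finset.coe_univ, Set.mem_prod, Set.mem_ofPred_eq, Set.mem_univ, and_true] at hc hc' heq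
            obtain ⟨hne, h1⟩ := hg c hc.1 hc.2
            obtain ⟨-, h2⟩ := hg c' hc'.1 hc'.2
            obtain ⟨h3, -, h4⟩ := h1 t
            have h5 := (h2 t').1
            rw [← heq] at h5
            have := hT.ancestor_unique hG (hc.2.trans hc'.2.symm) (h4 ▸ hle) h3 h5
            subst this
            cases t <;> cases t' <;> simp_all
  have := (key K le_rfl).trans (Finset.card_le_univ _)
  omega

/-- In a stable graph, a breadth-first search cannot see a tree for long. -/
lemma TreeLike.dist_lt (hG : G.Connected)
    (hs : ∀ u v, G.Adj u v → G.SwapStable u v ∨ G.SwapStable v u) {Q : ℕ}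
    (hcard : Fintype.card V ≤ 2 ^ Q) (hT : G.TreeLike r ((2 * Q + 1 + 3) * (Q + 1))) (v : V) :
    G.dist r v < (2 * Q + 1 + 3) * (Q + 1) := by
  by_contra hv
  -- A stem of length `2 * Q + 4` would give 2^(2Q+1) ≤ 2^(2Q), and `Q + 1` doublings would give
  -- 2^(Q+1) ≤ 2^Q.
  rcases hG.exists_isStem_or_two_pow_le hT ⟨v, by simp [Below], not_lt.1 hv⟩ with ⟨x, hx⟩ | h
  · have h1 := hx.two_pow_le_card_sq hT hG hs
    have h2 : 2 ^ (2 * Q + 1) ≤ 2 ^ Q * 2 ^ Q := h1.trans (Nat.mul_le_mul hcard hcard)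
    rw [← pow_add, Nat.pow_le_pow_iff_right (by norm_num)] at h2
    omega
  · have h2 := h.trans hcard
    rw [Nat.pow_le_pow_iff_right (by norm_num)] at h2
    omega

open Classical in
/-- The vertices at distance at most `k` from `u`. -/
noncomputable def ballFinset (G : SimpleGraph V) (u : V) (k : ℕ) : Finset V :=
  Finset.univ.filter fun v => G.dist u v ≤ k

lemma mem_ballFinset {u v : V} {k : ℕ} : v ∈ G.ballFinset u k ↔ G.dist u v ≤ k := by
  simp [ballFinset]

-- Swap the cheap edge at `x` for an edge to `a`. Measured against `dist x v + M`, no vertex does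
-- worse and each counted vertex saves at least `k - 1`. Stability bounds the total saving by `M`
-- per vertex.
open Classical in
lemma HasCheapEdge.card_mul_le (hG : G.Connected) {M k : ℕ} {u x a : V}
    (hx : G.HasCheapEdge M x) (hux : G.dist u x ≤ M) (hk : M + 1 ≤ k) (hk2 : 2 ≤ k)
    (ha : G.dist u a = 3 * k) :
    (Finset.univ.filter fun v => G.dist a v + k ≤ G.dist u v).card * (k - 1) ≤
      Fintype.card V * M := by
  obtain ⟨y, hxy, hs, hy⟩ := hx
  have htri := hG.dist_triangle (u := u) (v := x) (w := a)
  have hax : a ≠ x := by rintro rfl; omega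
  have hnadj : ¬ G.Adj x a := by
    intro h
    have := dist_eq_one_iff_adj.2 h
    omega
  have key := hs a hax hnadj (fun v => if G.dist a v + k ≤ G.dist u v then G.dist a v + 1 else
    G.dist x v + M) (by
      intro v
      split_ifs with h
      · have := hG.dist_triangle (u := u) (v := x) (w := v)
        exact edist_le_add_one (swapEdge_adj_new hax) (hG.edist_le_dist_of_adj_of_ne (x := x)
          (fun p q hp hq h => swapEdge_adj_of_ne hp hq h) a (by omega))
      · exact (edist_anti le_sup_left).trans (hy v))
  have h2 : ∑ v, ((if G.dist a v + k ≤ G.dist u v then G.dist a v + 1 else G.dist x v + M) +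
      (if G.dist a v + k ≤ G.dist u v then 1 else 0) * (k - 1)) ≤
      ∑ v, (G.dist x v + M) := by
    refine Finset.sum_le_sum fun v _ => ?_
    have := hG.dist_triangle (u := u) (v := x) (w := v)
    split_ifs <;> omega
  rw [Finset.sum_add_distrib, Finset.sum_add_distrib, ← Finset.sum_mul, ← Finset.card_filter,
    Finset.sum_const, Finset.card_univ, smul_eq_mul] at h2
  omega

lemma exists_maximal_separated (G : SimpleGraph V) (T : Finset V) (k : ℕ) :
    ∃ A ⊆ T, (∀ a ∈ A, ∀ b ∈ A, a ≠ b → k < G.dist a b) ∧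
      ∀ w ∈ T, ∃ a ∈ A, G.dist a w ≤ k := by
  classical
  obtain ⟨A, hA, hmax⟩ := Finset.exists_max_image
    (T.powerset.filter fun A => ∀ a ∈ A, ∀ b ∈ A, a ≠ b → k < G.dist a b) Finset.card
    ⟨∅, by simp⟩
  rw [Finset.mem_filter, Finset.mem_powerset] at hA
  refine ⟨A, hA.1, hA.2, fun w hw => ?_⟩
  by_contra hcon
  push Not at hcon
  have hwA : w ∉ A := by
    intro h
    have := hcon w h
    simp at this
  have := hmax (insert w A) (by
    rw [Finset.mem_filter, Finset.mem_powerset]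
    refine ⟨Finset.insert_subset hw hA.1, fun a ha b hb hab => ?_⟩
    rw [Finset.mem_insert] at ha hb
    rcases ha with rfl | ha <;> rcases hb with rfl | hb
    · exact absurd rfl hab
    · rw [dist_comm]
      exact hcon b hb
    · exact hcon a ha
    · exact hA.2 a ha b hb hab)
  rw [Finset.card_insert_of_notMem hwA] at this
  omega

/-- Small balls grow by a large factor when their radius is multiplied by four. -/
lemma HasCheapEdge.mul_le_card_ballFinset (hG : G.Connected) {M k c : ℕ} {u x : V}
    (hx : G.HasCheapEdge M x) (hux : G.dist u x ≤ M) (hk : M + 1 ≤ k) (hk2 : 2 ≤ k)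
    (hhalf : 2 * (G.ballFinset u (4 * k)).card ≤ Fintype.card V)
    (hc : ∀ a, G.dist u a = 3 * k → c ≤ (G.ballFinset a k).card) :
    k * c ≤ 4 * M * (G.ballFinset u (4 * k)).card := by
  classical
  obtain ⟨A, hAT, hsep, hcov⟩ := G.exists_maximal_separated
    (Finset.univ.filter fun w => G.dist u w = 3 * k) (2 * k)
  have hA : ∀ a ∈ A, G.dist u a = 3 * k := fun a ha => (Finset.mem_filter.1 (hAT ha)).2
  have hballs : A.card * c ≤ (G.ballFinset u (4 * k)).card := by
    calc A.card * c = ∑ a ∈ A, c := by rw [Finset.sum_const, smul_eq_mul]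
      _ ≤ ∑ a ∈ A, (G.ballFinset a k).card := Finset.sum_le_sum fun a ha => hc a (hA a ha)
      _ = (A.biUnion fun a => G.ballFinset a k).card := by
        rw [Finset.card_biUnion]
        intro a ha b hb hab
        rw [Function.onFun, Finset.disjoint_left]
        intro v hva hvb
        rw [mem_ballFinset] at hva hvb
        have h1 := hsep a ha b hb hab
        have h2 := hG.dist_triangle (u := a) (v := v) (w := b)
        rw [dist_comm (u := v)] at h2
        omega
      _ ≤ _ := by
        refine Finset.card_le_card fun v hv => ?_
        rw [Finset.mem_biUnion] at hv
        obtain ⟨a, ha, hv⟩ := hv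
        rw [mem_ballFinset] at hv ⊢
        have h1 := hG.dist_triangle (u := u) (v := a) (w := v)
        rw [hA a ha] at h1
        omega
  -- A geodesic from `u` to a vertex outside the ball crosses the sphere of radius `3 * k` at some
  -- `w`. A net point within `2 * k` of `w` is then closer to that vertex than `u` by at least `k`.
  have hfar : (G.ballFinset u (4 * k))ᶜ ⊆
      A.biUnion fun a => Finset.univ.filter fun v => G.dist a v + k ≤ G.dist u v := by
    intro v hv
    rw [Finset.mem_compl, mem_ballFinset, not_le] at hv
    obtain ⟨w, hw1, hw2⟩ := hG.exists_dist_eq u v (m := 3 * k) (by omega)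
    obtain ⟨a, ha, haw⟩ := hcov w (by simp [hw1])
    have h1 := hG.dist_triangle (u := a) (v := w) (w := v)
    simp only [Finset.mem_biUnion, Finset.mem_filter, Finset.mem_univ, true_and]
    exact ⟨a, ha, by omega⟩
  have hcardA : (G.ballFinset u (4 * k))ᶜ.card * (k - 1) ≤ A.card * (Fintype.card V * M) := by
    calc (G.ballFinset u (4 * k))ᶜ.card * (k - 1)
        ≤ (∑ a ∈ A, (Finset.univ.filter fun v => G.dist a v + k ≤ G.dist u v).card) * (k - 1) :=
          Nat.mul_le_mul ((Finset.card_le_card hfar).trans Finset.card_biUnion_le) le_rfl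
      _ = ∑ a ∈ A, (Finset.univ.filter fun v => G.dist a v + k ≤ G.dist u v).card * (k - 1) :=
          Finset.sum_mul _ _ _
      _ ≤ ∑ a ∈ A, Fintype.card V * M :=
          Finset.sum_le_sum fun a ha => hx.card_mul_le hG hux hk hk2 (hA a ha)
      _ = _ := by rw [Finset.sum_const, smul_eq_mul]
  rw [Finset.card_compl] at hcardA
  have hn : 0 < Fintype.card V := Fintype.card_pos_iff.2 ⟨u⟩
  have h1 : Fintype.card V * (k - 1) ≤ Fintype.card V * (2 * A.card * M) := by
    calc Fintype.card V * (k - 1)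
        ≤ 2 * (Fintype.card V - (G.ballFinset u (4 * k)).card) * (k - 1) :=
          Nat.mul_le_mul (by omega) le_rfl
      _ = 2 * ((Fintype.card V - (G.ballFinset u (4 * k)).card) * (k - 1)) := by ring
      _ ≤ 2 * (A.card * (Fintype.card V * M)) := Nat.mul_le_mul le_rfl hcardA
      _ = _ := by ring
  have h2 : k - 1 ≤ 2 * A.card * M := Nat.le_of_mul_le_mul_left h1 hn
  calc k * c ≤ (2 * (k - 1)) * c := Nat.mul_le_mul (by omega) le_rfl
    _ ≤ (2 * (2 * A.card * M)) * c := by gcongr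
    _ = 4 * M * (A.card * c) := by ring
    _ ≤ _ := by gcongr

/-- The starting radius makes `k / (4 * M)` at least `2 ^ s`, so each quadrupling multiplies the
ball size by `2 ^ s` until it exceeds half of the vertices. The size `2 ^ (s * (s + 1))` is out of
reach. -/
lemma Connected.dist_le_of_hasCheapEdge (hG : G.Connected) {M s : ℕ} (hM : 1 ≤ M) (hs : 1 ≤ s)
    (hcard : Fintype.card V ≤ 2 ^ (s * s))
    (hcheap : ∀ u, ∃ x, G.dist u x ≤ M ∧ G.HasCheapEdge M x) (u v : V) :
    G.dist u v ≤ 2 * (4 ^ (s + 1) * (4 * M * 2 ^ s)) := by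
  have key : ∀ i u, Fintype.card V < 2 * (G.ballFinset u (4 ^ i * (4 * M * 2 ^ s))).card ∨
      2 ^ (s * i) ≤ (G.ballFinset u (4 ^ i * (4 * M * 2 ^ s))).card := by
    intro i
    induction i with
    | zero =>
      intro u
      right
      rw [mul_zero, pow_zero, Nat.one_le_iff_ne_zero, ← Nat.pos_iff_ne_zero, Finset.card_pos]
      exact ⟨u, by simp [mem_ballFinset]⟩
    | succ i ih =>
      intro u
      obtain ⟨x, hux, hx⟩ := hcheap u
      rw [or_iff_not_imp_left, not_lt]
      intro hhalf
      have hklow : 4 * M * 2 ^ s ≤ 4 ^ i * (4 * M * 2 ^ s) :=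
        Nat.le_mul_of_pos_left _ (by positivity)
      have hM4 : 4 * M ≤ 4 * M * 2 ^ s := Nat.le_mul_of_pos_right _ (by positivity)
      set k := 4 ^ i * (4 * M * 2 ^ s) with hkdef
      have hk4 : 4 ^ (i + 1) * (4 * M * 2 ^ s) = 4 * k := by rw [hkdef]; ring
      rw [hk4] at hhalf ⊢
      have hgrow := hx.mul_le_card_ballFinset hG hux (by omega) (by omega) hhalf
        (c := 2 ^ (s * i)) (by
          intro a ha
          -- The ball around `a` lies inside the ball of radius `4 * k` around `u`, which has at
          -- most half of the vertices.
          refine (ih a).resolve_left fun hlt => ?_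
          have : (G.ballFinset a k).card ≤ (G.ballFinset u (4 * k)).card := by
            refine Finset.card_le_card fun v hv => ?_
            rw [mem_ballFinset] at hv ⊢
            have := hG.dist_triangle (u := u) (v := a) (w := v)
            omega
          omega)
      have h4M : 0 < 4 * M := by omega
      refine Nat.le_of_mul_le_mul_left ?_ h4M
      calc 4 * M * 2 ^ (s * (i + 1)) = 4 * M * 2 ^ s * 2 ^ (s * i) := by ring
        _ ≤ k * 2 ^ (s * i) := by gcongr
        _ ≤ _ := hgrow
  have hbig : ∀ u, Fintype.card V < 2 * (G.ballFinset u (4 ^ (s + 1) * (4 * M * 2 ^ s))).card := by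
    intro u
    refine (key (s + 1) u).resolve_right fun h => ?_
    have h1 := (h.trans (Finset.card_le_univ _)).trans hcard
    rw [Nat.pow_le_pow_iff_right (by norm_num), Nat.mul_le_mul_left_iff (by omega)] at h1
    omega
  classical
  obtain ⟨w, hw⟩ : (G.ballFinset u (4 ^ (s + 1) * (4 * M * 2 ^ s)) ∩
      G.ballFinset v (4 ^ (s + 1) * (4 * M * 2 ^ s))).Nonempty := by
    rw [Finset.nonempty_iff_ne_empty, Ne, ← Finset.disjoint_iff_inter_eq_empty]
    intro hd
    have h1 := Finset.card_le_univ ((G.ballFinset u (4 ^ (s + 1) * (4 * M * 2 ^ s))) ∪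
      G.ballFinset v (4 ^ (s + 1) * (4 * M * 2 ^ s)))
    rw [Finset.card_union_of_disjoint hd] at h1
    have := hbig u
    have := hbig v
    omega
  rw [Finset.mem_inter, mem_ballFinset, mem_ballFinset, dist_comm (u := v)] at hw
  have := hG.dist_triangle (u := u) (v := w) (w := v)
  omega

/-- A connected graph each of whose edges is stable at one of its ends has small diameter. -/
theorem Connected.dist_le_of_swapStable (hG : G.Connected)
    (hst : ∀ x y, G.Adj x y → G.SwapStable x y ∨ G.SwapStable y x) {s : ℕ} (hs : 1 ≤ s)
    (hcard : Fintype.card V ≤ 2 ^ (s * s)) (u v : V) :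
    G.dist u v ≤ 2 ^ (18 * s) := by
  set Q := s * s with hQ
  set L := (2 * Q + 1 + 3) * (Q + 1) with hL
  have hLpos : 1 ≤ L := by rw [hL]; nlinarith
  have hbound : 2 * (4 ^ (s + 1) * (4 * (2 * L) * 2 ^ s)) ≤ 2 ^ (18 * s) := by
    have h1 : s ≤ 2 ^ s := Nat.lt_two_pow_self.le
    have h2 : Q ≤ 4 ^ s := by
      calc Q ≤ 2 ^ s * 2 ^ s := Nat.mul_le_mul h1 h1
        _ = 4 ^ s := by rw [← mul_pow]; norm_num
    have h3 : 1 ≤ 4 ^ s := Nat.one_le_pow _ _ (by norm_num)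
    have h4 : L ≤ 12 * 16 ^ s := by
      calc L ≤ (6 * 4 ^ s) * (2 * 4 ^ s) := Nat.mul_le_mul (by omega) (by omega)
        _ = 12 * (4 ^ s * 4 ^ s) := by ring
        _ = 12 * 16 ^ s := by rw [← mul_pow]; norm_num
    calc 2 * (4 ^ (s + 1) * (4 * (2 * L) * 2 ^ s))
        ≤ 2 * (4 ^ (s + 1) * (4 * (2 * (12 * 16 ^ s)) * 2 ^ s)) := by gcongr
      _ = 768 * (4 ^ s * 16 ^ s * 2 ^ s) := by ring
      _ = 768 * 2 ^ (7 * s) := by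
        rw [← mul_pow, ← mul_pow, pow_mul]
        norm_num
      _ ≤ 2 ^ (11 * s) * 2 ^ (7 * s) := by
        gcongr
        calc 768 ≤ 2 ^ 11 := by norm_num
          _ ≤ 2 ^ (11 * s) := Nat.pow_le_pow_right (by norm_num) (by omega)
      _ = 2 ^ (18 * s) := by rw [← pow_add]; congr 1; ring
  refine le_trans ?_ hbound
  -- In the second case the cheap edges have `M = 2 * L`.
  by_cases hT : ∃ r, G.TreeLike r L
  · obtain ⟨r, hr⟩ := hT
    have h1 := TreeLike.dist_lt hG hst hcard hr u
    have h2 := TreeLike.dist_lt hG hst hcard hr v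
    rw [← hL] at h1 h2
    have h3 := hG.dist_triangle (u := u) (v := r) (w := v)
    rw [dist_comm (u := u) (v := r)] at h3
    have h4 : L ≤ 4 ^ (s + 1) * (4 * (2 * L) * 2 ^ s) := by
      calc L ≤ 4 * (2 * L) := by omega
        _ ≤ 4 * (2 * L) * 2 ^ s := Nat.le_mul_of_pos_right _ (by positivity)
        _ ≤ _ := Nat.le_mul_of_pos_left _ (by positivity)
    omega
  · push Not at hT
    refine hG.dist_le_of_hasCheapEdge (by omega) hs hcard (fun r => ?_) u v
    obtain ⟨x, hx, hx'⟩ := hG.exists_hasCheapEdge hst (hT r)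
    exact ⟨x, by omega, hx'⟩

end Growth

end SimpleGraph

/-! ### From the game to stable graphs, and disconnected equilibria. -/

namespace BudgetGame

variable {n : ℕ} {b : Fin n → ℕ} {S : Profile n}

lemma underlying_adj {i j : Fin n} : (underlying S).Adj i j ↔ i ≠ j ∧ (j ∈ S i ∨ i ∈ S j) :=
  SimpleGraph.fromRel_adj _ _ _

lemma dist_eq_of_connected (h : (underlying S).Connected) (u v : Fin n) :
    dist S u v = (underlying S).dist u v :=
  if_pos (h u v)

lemma dist_le_of_edist_le {u v : Fin n} {k : ℕ} (h : (underlying S).edist u v ≤ k) :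
    dist S u v ≤ k := by
  have hr : (underlying S).Reachable u v :=
    SimpleGraph.reachable_of_edist_ne_top (ne_top_of_le_ne_top (ENat.natCast_ne_top k) h)
  rw [dist, if_pos hr]
  rw [← hr.coe_dist_eq_edist] at h
  exact_mod_cast h

lemma dist_lt_of_reachable {u v : Fin n} (h : (underlying S).Reachable u v) : dist S u v < n := by
  rw [dist, if_pos h]
  obtain ⟨p, hp, hl⟩ := h.exists_path_of_dist
  rw [← hl]
  simpa using hp.length_lt

lemma dist_le_sq (u v : Fin n) : dist S u v ≤ n ^ 2 := by
  by_cases h : (underlying S).Reachable u v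
  · exact (dist_lt_of_reachable h).le.trans (Nat.le_self_pow two_ne_zero n)
  · rw [dist, if_neg h]

lemma diam_le_iff {k : ℕ} : diam S ≤ k ↔ ∀ u v, dist S u v ≤ k := by
  simp [diam]

lemma dist_le_diam (u v : Fin n) : dist S u v ≤ diam S := diam_le_iff.1 le_rfl u v

lemma one_le_diam (hn : 2 ≤ n) : 1 ≤ diam S := by
  have hne : (⟨0, by omega⟩ : Fin n) ≠ ⟨1, by omega⟩ := by simp
  refine le_trans ?_ (dist_le_diam (S := S) ⟨0, by omega⟩ ⟨1, by omega⟩)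
  rw [dist]
  split_ifs with h
  · exact h.pos_dist_of_ne hne
  · exact Nat.one_le_pow _ _ (by omega)

lemma diam_eq_of_not_connected (hn : 1 ≤ n) (h : ¬ (underlying S).Connected) :
    diam S = n ^ 2 := by
  have : Nonempty (Fin n) := ⟨⟨0, hn⟩⟩
  refine le_antisymm (diam_le_iff.2 dist_le_sq) ?_
  have : ¬ (underlying S).Preconnected := fun hp => h ⟨hp⟩
  simp only [SimpleGraph.Preconnected, not_forall] at this
  obtain ⟨u, v, huv⟩ := this
  have := dist_le_diam (S := S) u v
  rwa [dist, if_neg huv] at this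

lemma adj_update_of_ne {x : Fin n} {T : Finset (Fin n)} {p q : Fin n}
    (h : (underlying S).Adj p q) (hp : p = x → q ∈ S x → q ∈ T)
    (hq : q = x → p ∈ S x → p ∈ T) : (underlying (Function.update S x T)).Adj p q := by
  rw [underlying_adj] at h ⊢
  refine ⟨h.1, ?_⟩
  by_cases hpx : p = x
  · subst hpx
    have hqp : q ≠ p := h.1.symm
    rw [Function.update_self, Function.update_of_ne hqp]
    exact h.2.imp_left (hp rfl)
  · rw [Function.update_of_ne hpx]
    by_cases hqx : q = x
    · subst hqx
      rw [Function.update_self]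
      exact h.2.imp_right (hq rfl)
    · rw [Function.update_of_ne hqx]
      exact h.2

lemma IsSumEquilibrium.costSum_le_swap (h : IsSumEquilibrium b S) {x y z : Fin n}
    (hy : y ∈ S x) (hzx : z ≠ x) (hz : z ∉ S x) :
    costSum S x ≤ costSum (Function.update S x (insert z ((S x).erase y))) x := by
  refine h.2 x _ ?_ ?_
  · rw [Finset.mem_insert, not_or]
    exact ⟨hzx.symm, fun hx => (h.1 x).1 (Finset.mem_of_mem_erase hx)⟩
  · rw [Finset.card_insert_of_notMem (fun hx => hz (Finset.mem_of_mem_erase hx)),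
      Finset.card_erase_of_mem hy, ← (h.1 x).2]
    have := Finset.card_pos.2 ⟨y, hy⟩
    omega

lemma adj_update_new {x z : Fin n} {T : Finset (Fin n)} (hzx : z ≠ x) :
    (underlying (Function.update S x (insert z T))).Adj x z := by
  rw [underlying_adj]
  exact ⟨hzx.symm, Or.inl (by simp)⟩

/-- Redirecting the arc is an admissible deviation. Its graph contains the swapped graph, but may
also keep `xy` if `y` owns an arc to `x`; an extra edge only shortens distances. -/
lemma IsSumEquilibrium.swapStable (h : IsSumEquilibrium b S) (hc : (underlying S).Connected)
    {x y : Fin n} (hy : y ∈ S x) : (underlying S).SwapStable x y := by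
  intro z hzx hnadj f hf
  have hz : z ∉ S x := fun hz => hnadj (underlying_adj.2 ⟨hzx.symm, Or.inl hz⟩)
  have hle : (underlying S).swapEdge x y z ≤
      underlying (Function.update S x (insert z ((S x).erase y))) := by
    refine sup_le (fun p q hpq => ?_) (fun p q hpq => ?_)
    · rw [SimpleGraph.deleteEdges_adj] at hpq
      refine adj_update_of_ne hpq.1 ?_ ?_
      · rintro rfl hq
        refine Finset.mem_insert_of_mem (Finset.mem_erase.2 ⟨?_, hq⟩)
        rintro rfl
        exact hpq.2 rfl
      · rintro rfl hp
        refine Finset.mem_insert_of_mem (Finset.mem_erase.2 ⟨?_, hp⟩)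
        rintro rfl
        exact hpq.2 Sym2.eq_swap
    · rw [SimpleGraph.edge_adj] at hpq
      rcases hpq with ⟨⟨rfl, rfl⟩ | ⟨rfl, rfl⟩, -⟩
      · exact adj_update_new hzx
      · exact (adj_update_new hzx).symm
  have h1 := h.costSum_le_swap hy hzx hz
  unfold costSum at h1
  simp only [dist_eq_of_connected hc] at h1
  exact h1.trans (Finset.sum_le_sum fun v _ =>
    dist_le_of_edist_le ((SimpleGraph.edist_anti hle).trans (hf v)))

theorem IsSumEquilibrium.diam_le (h : IsSumEquilibrium b S) (hc : (underlying S).Connected)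
    {s : ℕ} (hs : 1 ≤ s) (hn : n ≤ 2 ^ (s * s)) : diam S ≤ 2 ^ (18 * s) := by
  rw [diam_le_iff]
  intro u v
  rw [dist_eq_of_connected hc]
  refine hc.dist_le_of_swapStable (fun x y hxy => ?_) hs (by simpa using hn) u v
  exact (underlying_adj.1 hxy).2.imp (h.swapStable hc) (h.swapStable hc)

/-- In a disconnected equilibrium, removing an arc separates its ends. -/
lemma IsSumEquilibrium.not_reachable_erase (h : IsSumEquilibrium b S)
    (hc : ¬ (underlying S).Connected) {x y : Fin n} (hy : y ∈ S x) :
    ¬ (underlying (Function.update S x ((S x).erase y))).Reachable x y := by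
  intro hr
  have hz : ∃ z, ¬ (underlying S).Reachable x z := by
    by_contra hcon
    push Not at hcon
    exact hc ((SimpleGraph.connected_iff_exists_forall_reachable _).2 ⟨x, hcon⟩)
  obtain ⟨z, hz⟩ := hz
  have hzx : z ≠ x := by
    rintro rfl
    exact hz (SimpleGraph.Reachable.refl _)
  have hzS : z ∉ S x := fun hz' =>
    hz (SimpleGraph.Adj.reachable (underlying_adj.2 ⟨hzx.symm, Or.inl hz'⟩))
  set S' := Function.update S x (insert z ((S x).erase y)) with hS'
  have hle : underlying (Function.update S x ((S x).erase y)) ≤ underlying S' := by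
    intro p q hpq
    have := adj_update_of_ne (x := x) (T := insert z ((S x).erase y)) hpq
      (fun _ hq => Finset.mem_insert_of_mem (by simpa using hq))
      (fun _ hq => Finset.mem_insert_of_mem (by simpa using hq))
    rwa [Function.update_idem] at this
  have hxy := hr.mono hle
  have hadj : ∀ p q, (underlying S).Adj p q → (underlying S').Reachable p q := by
    intro p q hpq
    by_cases h1 : p = x ∧ q = y
    · rw [h1.1, h1.2]
      exact hxy
    by_cases h2 : q = x ∧ p = y
    · rw [h2.1, h2.2]
      exact hxy.symm
    refine (adj_update_of_ne hpq (fun hp hq => ?_) (fun hq hp => ?_)).reachable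
    · exact Finset.mem_insert_of_mem (Finset.mem_erase.2 ⟨fun h' => h1 ⟨hp, h'⟩, hq⟩)
    · exact Finset.mem_insert_of_mem (Finset.mem_erase.2 ⟨fun h' => h2 ⟨hq, h'⟩, hp⟩)
  have hreach : ∀ u v, (underlying S).Reachable u v → (underlying S').Reachable u v := by
    rintro u v ⟨p⟩
    induction p with
    | nil => exact SimpleGraph.Reachable.refl _
    | cons hpq _ ih => exact (hadj _ _ hpq).trans ih
  have hcost : costSum S x ≤ costSum S' x := h.costSum_le_swap hy hzx hzS
  have hn : 2 ≤ n := by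
    have h1 := x.isLt
    have h2 := z.isLt
    have h3 : (z : ℕ) ≠ x := fun h' => hzx (Fin.ext h')
    omega
  -- Redirecting the redundant arc to `z` keeps the component of `x` connected, so distances there
  -- stay below `n`, while the distance `n ^ 2` to `z` drops to 1. The total loss, at most `n * (n -
  -- 1)`, is less than the `n ^ 2` credited at `z`.
  have hsum : ∑ v, (dist S' x v + if v = z then n ^ 2 else 0) ≤ ∑ v, (dist S x v + (n - 1)) := by
    refine Finset.sum_le_sum fun v _ => ?_
    split_ifs with hv
    · subst hv
      have h1 : dist S' x v ≤ 1 :=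
        dist_le_of_edist_le (SimpleGraph.edist_eq_one_iff_adj.2 (adj_update_new hzx)).le
      have h2 : dist S x v = n ^ 2 := if_neg hz
      omega
    · by_cases hv' : (underlying S).Reachable x v
      · have := dist_lt_of_reachable (hreach x v hv')
        omega
      · have h2 : dist S x v = n ^ 2 := if_neg hv'
        have := dist_le_sq (S := S') x v
        omega
  rw [Finset.sum_add_distrib, Finset.sum_add_distrib, Finset.sum_ite_eq' Finset.univ z,
    if_pos (Finset.mem_univ z), Finset.sum_const, Finset.card_univ, Fintype.card_fin,
    smul_eq_mul] at hsum
  unfold costSum at hcost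
  have : n * (n - 1) < n ^ 2 := by
    rw [pow_two]
    exact Nat.mul_lt_mul_of_pos_left (by omega) (by omega)
  omega

lemma edgeSet_underlying_subset : (underlying S).edgeSet ⊆
    ((Finset.univ.sigma S).image fun a => s(a.1, a.2) : Finset (Sym2 (Fin n))) := by
  intro e he
  induction e with
  | _ i j =>
    rw [SimpleGraph.mem_edgeSet, underlying_adj] at he
    simp only [Finset.coe_image, Set.mem_image, Finset.mem_coe, Finset.mem_sigma, Finset.mem_univ,
      true_and]
    rcases he.2 with h | h
    · exact ⟨⟨i, j⟩, h, rfl⟩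
    · exact ⟨⟨j, i⟩, h, Sym2.eq_swap⟩

lemma IsRealization.card_arcs (h : IsRealization b S) :
    (Finset.univ.sigma S).card = ∑ i, b i := by
  rw [Finset.card_sigma]
  exact Finset.sum_congr rfl fun i _ => (h i).2

lemma IsRealization.le_sum_add_one (h : IsRealization b S) (hc : (underlying S).Connected) :
    n ≤ ∑ i, b i + 1 := by
  have h1 := hc.card_vert_le_card_edgeSet_add_one
  have h2 := Set.ncard_le_ncard (edgeSet_underlying_subset (S := S)) (Finset.finite_toSet _)
  rw [Set.ncard_coe_finset] at h2
  rw [Nat.card_eq_fintype_card, Fintype.card_fin, Nat.card_coe_set_eq] at h1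
  have h3 := h2.trans Finset.card_image_le
  rw [h.card_arcs] at h3
  omega

/-- The budgets of a disconnected equilibrium do not suffice for a connected realization. -/
lemma IsSumEquilibrium.sum_add_one_lt (h : IsSumEquilibrium b S) (hn : 1 ≤ n)
    (hc : ¬ (underlying S).Connected) : ∑ i, b i + 1 < n := by
  have : Nonempty (Fin n) := ⟨⟨0, hn⟩⟩
  have hdel : ∀ x y, y ∈ S x → (underlying S).deleteEdges {s(x, y)} ≤
      underlying (Function.update S x ((S x).erase y)) := by
    intro x y _ p q hpq
    rw [SimpleGraph.deleteEdges_adj] at hpq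
    refine adj_update_of_ne hpq.1 ?_ ?_
    · rintro rfl hq
      refine Finset.mem_erase.2 ⟨?_, hq⟩
      rintro rfl
      exact hpq.2 rfl
    · rintro rfl hp
      refine Finset.mem_erase.2 ⟨?_, hp⟩
      rintro rfl
      exact hpq.2 Sym2.eq_swap
  have hacyc : (underlying S).IsAcyclic := by
    rw [SimpleGraph.isAcyclic_iff_forall_adj_isBridge]
    intro x y hxy
    rcases (underlying_adj.1 hxy).2 with hy | hx
    · rw [SimpleGraph.isBridge_iff]
      exact fun hr => h.not_reachable_erase hc hy (hr.mono (hdel x y hy))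
    · rw [Sym2.eq_swap, SimpleGraph.isBridge_iff]
      exact fun hr => h.not_reachable_erase hc hx (hr.mono (hdel y x hx))
  -- There are no braces: removing one arc of a brace would leave its ends adjacent. Hence arcs and
  -- edges are equal in number.
  have hinj : Set.InjOn (fun a : (_ : Fin n) × Fin n => s(a.1, a.2))
      (Finset.univ.sigma S : Finset ((_ : Fin n) × Fin n)) := by
    rintro ⟨i, j⟩ hij ⟨k, l⟩ hkl heq
    simp only [Finset.coe_sigma, Set.mem_sigma_iff, Finset.mem_coe, Finset.mem_univ,
      true_and] at hij hkl
    rcases Sym2.eq_iff.1 heq with ⟨h1, h2⟩ | ⟨h1, h2⟩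
    · dsimp only at h1 h2
      rw [h1, h2]
    · dsimp only at h1 h2
      subst h1 h2
      refine absurd (SimpleGraph.Adj.reachable ?_) (h.not_reachable_erase hc hij)
      have hne : j ≠ i := by
        rintro rfl
        exact (h.1 j).1 hij
      rw [underlying_adj, Function.update_of_ne hne]
      exact ⟨hne.symm, Or.inr hkl⟩
  have hsub : (((Finset.univ.sigma S).image fun a => s(a.1, a.2) : Finset (Sym2 (Fin n))) :
      Set (Sym2 (Fin n))) ⊆ (underlying S).edgeSet := by
    intro e he
    simp only [Finset.coe_image, Set.mem_image, Finset.mem_coe, Finset.mem_sigma, Finset.mem_univ,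
      true_and] at he
    obtain ⟨⟨i, j⟩, hij, rfl⟩ := he
    rw [SimpleGraph.mem_edgeSet, underlying_adj]
    refine ⟨fun hne => ?_, Or.inl hij⟩
    dsimp only at hne hij
    subst hne
    exact (h.1 _).1 hij
  have hcard := Set.ncard_le_ncard hsub (Set.toFinite _)
  rw [Set.ncard_coe_finset, Finset.card_image_of_injOn hinj, h.1.card_arcs] at hcard
  -- The forest is properly contained in a spanning tree of the complete graph, which has `n - 1`
  -- edges.
  obtain ⟨T, hT, -, htree⟩ :=
    SimpleGraph.connected_top.exists_isTree_le_of_le_of_isAcyclic (le_top) hacyc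
  have hTcard := (SimpleGraph.isTree_iff_connected_and_card.1 htree).2
  rw [Nat.card_fin, Nat.card_coe_set_eq] at hTcard
  have hlt : (underlying S).edgeSet ⊂ T.edgeSet := by
    rw [SimpleGraph.edgeSet_ssubset_edgeSet]
    refine lt_of_le_of_ne hT ?_
    rintro rfl
    exact hc htree.1
  have := Set.ncard_lt_ncard hlt (Set.toFinite _)
  omega

/-- Take `s` to be the square root rounded up. The root is at least 1, so `s` is at most twice the
root and 36 = 2·18. -/
lemma exists_nat_sqrt_logb (hn : 2 ≤ n) : ∃ s : ℕ, 1 ≤ s ∧ n ≤ 2 ^ (s * s) ∧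
    ((2 ^ (18 * s) : ℕ) : ℝ) ≤ (2 : ℝ) ^ ((36 : ℝ) * Real.sqrt (Real.logb 2 (n : ℝ))) := by
  have hn' : (2 : ℝ) ≤ n := by exact_mod_cast hn
  have hlog : 1 ≤ Real.logb 2 (n : ℝ) := by
    rw [Real.le_logb_iff_rpow_le (by norm_num) (by linarith)]
    simpa using hn'
  have hsqrt : 1 ≤ Real.sqrt (Real.logb 2 (n : ℝ)) := Real.one_le_sqrt.2 hlog
  refine ⟨⌈Real.sqrt (Real.logb 2 (n : ℝ))⌉₊, Nat.one_le_ceil_iff.2 (by linarith), ?_, ?_⟩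
  · have h1 := Nat.le_ceil (Real.sqrt (Real.logb 2 (n : ℝ)))
    have h2 : Real.logb 2 (n : ℝ) ≤
        ((⌈Real.sqrt (Real.logb 2 (n : ℝ))⌉₊ * ⌈Real.sqrt (Real.logb 2 (n : ℝ))⌉₊ : ℕ) : ℝ) := by
      push_cast
      calc Real.logb 2 (n : ℝ) = Real.sqrt (Real.logb 2 (n : ℝ)) * Real.sqrt (Real.logb 2 (n : ℝ)) :=
            (Real.mul_self_sqrt (by linarith)).symm
        _ ≤ _ := mul_self_le_mul_self (by linarith) h1
    rw [Real.logb_le_iff_le_rpow (by norm_num) (by linarith), Real.rpow_natCast] at h2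
    exact_mod_cast h2
  · have h1 := (Nat.ceil_lt_add_one (show 0 ≤ Real.sqrt (Real.logb 2 (n : ℝ)) by linarith)).le
    push_cast
    rw [← Real.rpow_natCast]
    refine Real.rpow_le_rpow_of_exponent_le (by norm_num) ?_
    push_cast
    linarith

lemma IsSumEquilibrium.diam_le_rpow (h : IsSumEquilibrium b S) (hc : (underlying S).Connected) :
    (diam S : ℝ) ≤ (2 : ℝ) ^ ((36 : ℝ) * Real.sqrt (Real.logb 2 (n : ℝ))) := by
  rcases lt_or_ge n 2 with hn | hn
  · have : diam S ≤ 0 := by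
      rw [diam_le_iff]
      intro u v
      have := dist_lt_of_reachable (hc u v)
      have huv : u = v := Fin.ext (by omega)
      subst huv
      rw [dist_eq_of_connected hc, SimpleGraph.dist_self]
    have h0 : diam S = 0 := by omega
    rw [h0, Nat.cast_zero]
    positivity
  · obtain ⟨s, hs, hns, hle⟩ := exists_nat_sqrt_logb hn
    exact le_trans (by exact_mod_cast h.diam_le hc hs hns) hle

theorem priceOfAnarchySum_le (hn : 2 ≤ n) (b : Fin n → ℕ) (hb : ∀ i, b i < n) :
    priceOfAnarchySum b ≤ (2 : ℝ) ^ ((36 : ℝ) * Real.sqrt (Real.logb 2 (n : ℝ))) := by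
  have hone : (1 : ℝ) ≤ (2 : ℝ) ^ ((36 : ℝ) * Real.sqrt (Real.logb 2 (n : ℝ))) :=
    Real.one_le_rpow (by norm_num) (by positivity)
  have hne : {d : ℕ | ∃ S : Profile n, IsRealization b S ∧ diam S = d}.Nonempty := by
    have hex : ∀ i, ∃ T : Finset (Fin n), i ∉ T ∧ T.card = b i := by
      intro i
      obtain ⟨T, hT, hcard⟩ := Finset.exists_subset_card_eq (s := Finset.univ.erase i) (n := b i)
        (by
          rw [Finset.card_erase_of_mem (Finset.mem_univ i), Finset.card_univ, Fintype.card_fin]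
          have := hb i
          omega)
      exact ⟨T, fun hi => Finset.notMem_erase i _ (hT hi), hcard⟩
    choose S hS using hex
    exact ⟨_, S, hS, rfl⟩
  obtain ⟨S₀, hS₀, hopt⟩ := Nat.sInf_mem hne
  unfold priceOfAnarchySum
  rw [← hopt]
  have hpos : (1 : ℝ) ≤ diam S₀ := by exact_mod_cast one_le_diam hn
  rw [div_le_iff₀ (by linarith)]
  -- Existence of an equilibrium is not needed: the supremum of the empty set is 0.
  rcases Set.eq_empty_or_nonempty {d : ℕ | ∃ S : Profile n, IsSumEquilibrium b S ∧ diam S = d}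
    with hE | hE
  · rw [hE, csSup_empty]
    simp only [bot_eq_zero', Nat.cast_zero]
    positivity
  have hbdd : BddAbove {d : ℕ | ∃ S : Profile n, IsSumEquilibrium b S ∧ diam S = d} := by
    refine ⟨n ^ 2, ?_⟩
    rintro _ ⟨S, -, rfl⟩
    exact diam_le_iff.2 dist_le_sq
  obtain ⟨S, hS, hmax⟩ := Nat.sSup_mem hE hbdd
  rw [← hmax]
  by_cases hc : (underlying S).Connected
  · calc (diam S : ℝ) ≤ _ := hS.diam_le_rpow hc
      _ ≤ _ := le_mul_of_one_le_right (by linarith) hpos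
  -- Here no realization is connected, so both diameters equal `n ^ 2`.
  · have hlt := hS.sum_add_one_lt (by omega) hc
    have hc₀ : ¬ (underlying S₀).Connected := fun h₀ => by
      have := hS₀.le_sum_add_one h₀
      omega
    rw [diam_eq_of_not_connected (by omega) hc, diam_eq_of_not_connected (by omega) hc₀]
    exact le_mul_of_one_le_left (by positivity) hone

end BudgetGame

theorem theoremt :
    (∃ C : ℝ, 0 < C ∧
      ∀ (n : ℕ), 1 ≤ n → ∀ (b : Fin n → ℕ), (∀ i, b i < n) →
        ∀ S : BudgetGame.Profile n, BudgetGame.IsSumEquilibrium b S →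
          (BudgetGame.underlying S).Connected →
            (BudgetGame.diam S : ℝ) ≤ (2 : ℝ) ^ (C * Real.sqrt (Real.logb 2 (n : ℝ)))) ∧
    (∃ C : ℝ, 0 < C ∧
      ∀ (n : ℕ), 2 ≤ n → ∀ (b : Fin n → ℕ), (∀ i, b i < n) →
        BudgetGame.priceOfAnarchySum b ≤
          (2 : ℝ) ^ (C * Real.sqrt (Real.logb 2 (n : ℝ)))) := by
  exact ⟨⟨36, by norm_num, fun _ _ _ _ _ hS hc => hS.diam_le_rpow hc⟩,
    ⟨36, by norm_num, fun _ hn b hb => BudgetGame.priceOfAnarchySum_le hn b hb⟩⟩
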